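/- Let $G=(V,E)$ be a finite simple graph. Let $\mathcal A_{\mathrm{tor}}(G)\subseteq\mathbb R^V/\mathbb Z^V$ be the set of points $x$ with $x_i=x_j$ for some edge $\{i,j\}\in E$. A toric poset over $G$ is (given by) a toric chamber of $G$, i.e. a connected component $c$ of $(\mathbb R^V/\mathbb Z^V)\setminus\mathcal A_{\mathrm{tor}}(G)$. A point $x\notin\mathcal A_{\mathrm{tor}}(G)$ induces the acyclic orientation $\omega(x)$ of $G$ in which an edge $\{i,j\}$ is directed $i\to j$ iff $x_i<x_j$, where the coordinates are represented in $[0,1)$. For an acyclic orientation $\omega$ of $G$, let $[\omega]$ be its class under the equivalence relation generated by converting a source into a sink, and let $P(G,[\omega])$ be the toric poset whose chamber $c$ contains a point $x$ with $\omega(x)=\omega$. For a partition $\pi$ of $V$, let $G/{\sim_\pi}$ be the simple graph obtained from $G$ by collapsing each block to a vertex (loops and multiple edges removed), and let $\omega/{\sim_\pi}$ be the directed graph obtained in the same way from $\omega$. Put $D^{\mathrm{tor}}_\pi=\{x\in\mathbb R^V/\mathbb Z^V: x_i=x_j \text{ whenever } i,j \text{ lie in the same block of }\pi\}$ and $\bar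 F^{\mathrm{tor}}_\pi=\bar c\cap D^{\mathrm{tor}}_\pi$, let $F^{\mathrm{tor}}_\pi$ be the interior of $\bar F^{\mathrm{tor}}_\pi$ in $D^{\mathrm{tor}}_\pi$, and let $\bar r_\pi\colon D^{\mathrm{tor}}_\pi\to\mathbb R^{\pi}/\mathbb Z^{\pi}$ be the homeomorphism that keeps one coordinate per block. The partition $\pi$ is closed with respect to $P$ if it equals the join of all coarsenings $\pi'\ge\pi$ with $\bar F^{\mathrm{tor}}_{\pi'}=\bar F^{\mathrm{tor}}_\pi$. Contracting $G$ by $\pi$ yields a (quotient) toric morphism from $P$ to a toric poset over $G/{\sim_\pi}$ with chamber $c'$ if $\pi$ is closed with respect to $P$ and $c'\subseteq\bar r_\pi(F^{\mathrm{tor}}_\pi)$, i.e. $c'$ arises from the projection $F^{\mathrm{tor}}_\pi$ of $c$ by adding the toric hyperplanes of $G/{\sim_\pi}$. **Corollary.** Let $P=P(G,[\omega])$ be a toric poset and let $\pi$ be any partition of $V$. Contracting $G$ by $\pi$ yields a toric morphism from $P$ to some toric poset over $G/{\sim_\pi}$ if and only if $\omega'/{\sim_\pi}$ is acyclic for some $\omega'\in[\omega]$.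 -/

import Mathlib

/-- An acyclic orientation of a simple graph `G`: every edge is directed in (at least, hence by
acyclicity exactly) one way, and there is no directed cycle. -/
@[ext]
structure AcyclicOrientation {V : Type*} (G : SimpleGraph V) where
  /-- `Arc i j` means that the edge `{i, j}` is directed `i → j`. -/
  Arc : V → V → Prop
  adj_iff : ∀ i j, G.Adj i j ↔ Arc i j ∨ Arc j i
  acyclic : ∀ v, ¬ Relation.TransGen Arc v v

/-- `ω'` arises from `ω` by converting a source `v` into a sink: all edges at `v` are reversed,
all other edges keep their direction. -/
def AcyclicOrientation.FlipsTo {V : Type*} {G : SimpleGraph V}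
    (ω ω' : AcyclicOrientation G) : Prop :=
  ∃ v, (∀ u, ¬ ω.Arc u v) ∧
    ∀ i j, ω'.Arc i j ↔
      (i ≠ v ∧ j ≠ v ∧ ω.Arc i j) ∨ ((i = v ∨ j = v) ∧ ω.Arc j i)

/-- Toric equivalence `ω ≡ ω'`: the equivalence relation generated by source-to-sink conversions. -/
def AcyclicOrientation.ToricEquiv {V : Type*} {G : SimpleGraph V}
    (ω ω' : AcyclicOrientation G) : Prop :=
  Relation.EqvGen AcyclicOrientation.FlipsTo ω ω'

/-- The arcs of the directed graph `ω/∼π` on the blocks of `π` (loops removed). -/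
def AcyclicOrientation.quotientArc {V : Type*} {G : SimpleGraph V} (ω : AcyclicOrientation G)
    (π : Setoid V) (B C : Quotient π) : Prop :=
  B ≠ C ∧ ∃ i j, Quotient.mk π i = B ∧ Quotient.mk π j = C ∧ ω.Arc i j

/-- The directed graph `ω/∼π` is acyclic. -/
def AcyclicOrientation.QuotientAcyclic {V : Type*} {G : SimpleGraph V}
    (ω : AcyclicOrientation G) (π : Setoid V) : Prop :=
  ∀ B, ¬ Relation.TransGen (ω.quotientArc π) B B

/-- The graph `G/∼π` on the blocks of `π` (loops and multiple edges removed). -/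
def quotientGraph {V : Type*} (G : SimpleGraph V) (π : Setoid V) : SimpleGraph (Quotient π) where
  Adj B C := B ≠ C ∧ ∃ i j, Quotient.mk π i = B ∧ Quotient.mk π j = C ∧ G.Adj i j
  symm := ⟨fun _ _ ⟨hne, i, j, hi, hj, h⟩ => ⟨hne.symm, j, i, hj, hi, h.symm⟩⟩
  loopless := ⟨fun _ h => h.1 rfl⟩

/-- The toric graphic arrangement, as a set of points of the torus `ℝ^V/ℤ^V`, which is written
`V → UnitAddCircle`. -/
def toricArrangement {V : Type*} (G : SimpleGraph V) : Set (V → UnitAddCircle) :=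
  {x | ∃ i j, G.Adj i j ∧ x i = x j}

/-- A toric chamber of `G`: a connected component of the complement of the toric graphic
arrangement. These are the toric posets over `G`. -/
def IsToricChamber {V : Type*} (G : SimpleGraph V) (c : Set (V → UnitAddCircle)) : Prop :=
  ∃ x ∈ (toricArrangement G)ᶜ, c = connectedComponentIn (toricArrangement G)ᶜ x

/-- The representative in `[0, 1)` of a point of `ℝ/ℤ`. -/
noncomputable def modOne (t : UnitAddCircle) : ℝ :=
  (AddCircle.equivIco (1 : ℝ) 0 t : ℝ)

/-- The directed graph on `V` determined by a point `x` of the torus: the edge `{i, j}` of `G` is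
directed `i → j` when `x_i mod 1 ≤ x_j mod 1`. -/
def toricDigraph {V : Type*} (G : SimpleGraph V) (x : V → UnitAddCircle) (i j : V) : Prop :=
  G.Adj i j ∧ modOne (x i) ≤ modOne (x j)

/-- `c` is (the chamber of) the toric poset `P(G,[ω])`: it is the toric chamber of `G` that
corresponds to the class of `ω` under `x ↦ toricDigraph G x`, that is, the one containing a point
which induces `ω`. -/
def IsToricPosetOf {V : Type*} (G : SimpleGraph V) (ω : AcyclicOrientation G)
    (c : Set (V → UnitAddCircle)) : Prop :=
  IsToricChamber G c ∧ ∃ x ∈ c, toricDigraph G x = ω.Arc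

/-- The toric subspace `D_π` of points that are constant on the blocks of `π`. -/
def toricFlat {V : Type*} (π : Setoid V) : Set (V → UnitAddCircle) :=
  {x | ∀ i j, π i j → x i = x j}

/-- The intersection of the closed toric chamber with `D_π`. -/
def toricClosedFace {V : Type*} (c : Set (V → UnitAddCircle)) (π : Setoid V) :
    Set (V → UnitAddCircle) :=
  closure c ∩ toricFlat π

/-- The interior of `toricClosedFace c π` in the subspace topology of `D_π`. -/
def toricOpenFace {V : Type*} (c : Set (V → UnitAddCircle)) (π : Setoid V) :
    Set (V → UnitAddCircle) :=
  Subtype.val '' interior (Subtype.val ⁻¹' toricClosedFace c π : Set (toricFlat π))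

/-- The closure of a partition with respect to a toric poset: the lattice join of all coarsenings
of `π` that cut out the same part of the closed chamber. -/
def toricPartitionClosure {V : Type*} (c : Set (V → UnitAddCircle)) (π : Setoid V) : Setoid V :=
  sSup {π' | π ≤ π' ∧ toricClosedFace c π' = toricClosedFace c π}

/-- The coordinate projection of `ℝ^V/ℤ^V` that keeps one coordinate from each block of `π`.
On `D_π` it does not depend on the chosen representatives. -/
noncomputable def blockProjection {V : Type*} (π : Setoid V) (x : V → UnitAddCircle) :
    Quotient π → UnitAddCircle :=
  fun B => x B.out

/-- Contracting `G` by `π` gives a quotient morphism from the toric poset with chamber `c` to the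
toric poset with chamber `c'` over `G/∼π`: the partition `π` is closed with respect to the source,
and after projecting `c` to the open face in `D_π`, and this homeomorphically to the torus
indexed by the blocks, the chamber `c'` is a part of the result (the rest being separated from it
by toric hyperplanes of `G/∼π`). -/
structure IsToricQuotientMorphism {V : Type*} (G : SimpleGraph V) (π : Setoid V)
    (c : Set (V → UnitAddCircle)) (c' : Set (Quotient π → UnitAddCircle)) : Prop where
  source : IsToricChamber G c
  target : IsToricChamber (quotientGraph G π) c'
  closed : toricPartitionClosure c π = π
  subset_face : c' ⊆ blockProjection π '' toricOpenFace c π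

/-! ### Finite acyclic digraphs -/

/-! Both sides are equivalent to the existence of a point `y` off the toric hyperplanes of `G/∼π`
whose lift `blockLift π y` lies in the closed chamber. A quotient morphism supplies such a `y`,
namely any point of its target chamber. Conversely, near the lift of such a point the flat of `π`
lies entirely in the closed chamber (`mem_toricOpenFace_of_mem_closure`), so the whole chamber of
`G/∼π` around `y` stays in the open face. If moreover the coordinates of `y` are distinct, then `π`
is closed.

To pass to orientations, perturb the lift of `y` into the chamber: arcs between blocks follow the
order of the coordinates of `y`, so the quotient is acyclic. In the other direction, a linear
extension of `ω'/∼π` places the blocks at distinct points of the circle, and a small perturbation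
inside each block induces `ω'`.

Chambers are matched with toric classes through height functions. The integral parts of a lifted
point change along a chamber exactly by a coboundary correcting the change of arcs, and a flip at
`v` is the case where the height is the indicator of `v`. Hence `HeightEquiv` describes both "same
chamber" and "torically equivalent". -/

/-- A relation along which some integer-valued function strictly increases has no directed cycle. -/
theorem acyclic_of_strictMono {α β : Type*} [Preorder β] {r : α → α → Prop} {f : α → β}
    (hf : ∀ a b, r a b → f a < f b) (a : α) : ¬ Relation.TransGen r a a := by
  have key : ∀ b, Relation.TransGen r a b → f a < f b := by
    intro b h
    induction h with
    | single h => exact hf _ _ h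
    | tail _ h ih => exact ih.trans (hf _ _ h)
  exact fun h => lt_irrefl _ (key a h)

/-- A finite acyclic digraph has a linear extension. -/
theorem exists_injective_strictMono_of_acyclic {α : Type*} [Finite α] {r : α → α → Prop}
    (hr : ∀ a, ¬ Relation.TransGen r a a) :
    ∃ f : α → ℕ, Function.Injective f ∧ ∀ a b, r a b → f a < f b := by
  obtain ⟨n, ⟨e⟩⟩ := Finite.exists_equiv_fin α
  let h : α → ℕ := fun a => {c | Relation.TransGen r c a}.ncard
  have hh : ∀ a b, r a b → h a < h b := by
    intro a b hab
    refine Set.ncard_lt_ncard ⟨fun c hc => Relation.TransGen.tail hc hab, fun hsub => ?_⟩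
      (Set.toFinite _)
    exact hr a (hsub (Relation.TransGen.single hab))
  -- Rank by the number of ancestors; the enumeration `e` breaks ties as the last digit in base `n`.
  refine ⟨fun a => h a * n + e a, fun a b hab => ?_, fun a b hab => ?_⟩
  · have h1 : (h a * n + e a) % n = (h b * n + e b) % n := congrArg (· % n) hab
    rw [Nat.mul_add_mod_of_lt (e a).2, Nat.mul_add_mod_of_lt (e b).2] at h1
    exact e.injective (Fin.ext h1)
  · have h1 := hh a b hab
    have h2 := (e a).2
    have h3 : (h a + 1) * n ≤ h b * n := Nat.mul_le_mul_right n h1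
    change h a * n + e a < h b * n + e b
    rw [Nat.succ_mul] at h3
    omega

/-! ### Toric equivalence through height functions -/

open Classical in
/-- The indicator function of a relation. -/
noncomputable def arcIndicator {V : Type*} (A : V → V → Prop) (i j : V) : ℤ :=
  if A i j then 1 else 0

theorem arcIndicator_of {V : Type*} {A : V → V → Prop} {i j : V} (h : A i j) :
    arcIndicator A i j = 1 := if_pos h

theorem arcIndicator_of_not {V : Type*} {A : V → V → Prop} {i j : V} (h : ¬ A i j) :
    arcIndicator A i j = 0 := if_neg h

/-- Two digraphs supported on `G` are height equivalent if their indicator functions differ, on the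
edges of `G`, by the coboundary of an integer-valued function on the vertices. -/
def HeightEquiv {V : Type*} (G : SimpleGraph V) (A A' : V → V → Prop) : Prop :=
  ∃ m : V → ℤ, ∀ i j, G.Adj i j → m i - m j = arcIndicator A i j - arcIndicator A' i j

namespace HeightEquiv

variable {V : Type*} {G : SimpleGraph V} {A B C : V → V → Prop}

theorem refl (G : SimpleGraph V) (A : V → V → Prop) : HeightEquiv G A A :=
  ⟨fun _ => 0, fun _ _ _ => by ring⟩

theorem symm (h : HeightEquiv G A B) : HeightEquiv G B A := by
  obtain ⟨m, hm⟩ := h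
  exact ⟨fun i => - m i, fun i j hij => by linarith [hm i j hij]⟩

theorem trans (h : HeightEquiv G A B) (h' : HeightEquiv G B C) : HeightEquiv G A C := by
  obtain ⟨m, hm⟩ := h
  obtain ⟨m', hm'⟩ := h'
  exact ⟨fun i => m i + m' i, fun i j hij => by linarith [hm i j hij, hm' i j hij]⟩

end HeightEquiv

namespace AcyclicOrientation

variable {V : Type*} {G : SimpleGraph V}

theorem Arc.adj {ω : AcyclicOrientation G} {i j : V} (h : ω.Arc i j) : G.Adj i j :=
  (ω.adj_iff i j).2 (Or.inl h)

open Classical in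
/-- The orientation obtained by converting the source `v` into a sink has a height function that
is the indicator function of `v`. -/
theorem height_of_flip {ω ω' : AcyclicOrientation G} {v : V} (hv : ∀ u, ¬ ω.Arc u v)
    (h : ∀ i j, ω'.Arc i j ↔
      (i ≠ v ∧ j ≠ v ∧ ω.Arc i j) ∨ ((i = v ∨ j = v) ∧ ω.Arc j i))
    {i j : V} (hij : G.Adj i j) :
    (if i = v then (1 : ℤ) else 0) - (if j = v then 1 else 0) =
      arcIndicator ω.Arc i j - arcIndicator ω'.Arc i j := by
  unfold arcIndicator
  rw [if_congr (h i j) rfl rfl]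
  have hne := hij.ne
  have h1 := (ω.adj_iff i j).1 hij
  by_cases hi : i = v
  · subst hi
    have h2 := hv j
    have h3 : ω.Arc i j := h1.resolve_right h2
    simp [hne.symm, h2, h3]
  · by_cases hj : j = v
    · subst hj
      have h2 := hv i
      have h3 : ω.Arc j i := h1.resolve_left h2
      simp [hne, h2, h3]
    · simp [hi, hj]

theorem FlipsTo.heightEquiv {ω ω' : AcyclicOrientation G} (h : ω.FlipsTo ω') :
    HeightEquiv G ω.Arc ω'.Arc := by
  classical
  obtain ⟨v, hv, h⟩ := h
  exact ⟨fun i => if i = v then 1 else 0, fun i j hij => by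
    convert height_of_flip hv h hij⟩

theorem ToricEquiv.heightEquiv {ω ω' : AcyclicOrientation G} (h : ω.ToricEquiv ω') :
    HeightEquiv G ω.Arc ω'.Arc := by
  induction h with
  | rel _ _ h => exact h.heightEquiv
  | refl _ => exact HeightEquiv.refl G _
  | symm _ _ _ ih => exact ih.symm
  | trans _ _ _ _ _ ih ih' => exact ih.trans ih'

/-- Every source of an acyclic orientation can be converted into a sink. -/
theorem exists_flip [Finite V] (ω : AcyclicOrientation G) {v : V} (hv : ∀ u, ¬ ω.Arc u v) :
    ∃ ω' : AcyclicOrientation G, ∀ i j, ω'.Arc i j ↔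
      (i ≠ v ∧ j ≠ v ∧ ω.Arc i j) ∨ ((i = v ∨ j = v) ∧ ω.Arc j i) := by
  classical
  obtain ⟨f, -, hf⟩ := exists_injective_strictMono_of_acyclic ω.acyclic
  obtain ⟨N, hN⟩ := (Set.finite_range f).bddAbove
  have hN : ∀ i, f i ≤ N := fun i => hN ⟨i, rfl⟩
  refine ⟨⟨fun i j => (i ≠ v ∧ j ≠ v ∧ ω.Arc i j) ∨ ((i = v ∨ j = v) ∧ ω.Arc j i), ?_, ?_⟩,
    fun i j => Iff.rfl⟩
  · intro i j
    rw [ω.adj_iff]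
    tauto
  -- The new sink `v` is placed above all other vertices.
  · refine acyclic_of_strictMono (f := fun i => if i = v then N + 1 else f i) ?_
    rintro i j (⟨hi, hj, h⟩ | ⟨hij, h⟩)
    · simpa [hi, hj] using hf i j h
    · have hi : i ≠ v := by
        rintro rfl
        exact hv j h
      have hj : j = v := hij.resolve_left hi
      simp only [hi, hj, if_true, if_false]
      exact Nat.lt_succ_of_le (hN i)

/-- Induction on the total height. Among the vertices of maximal height, one that is minimal for `ω`
is a source: an arc `u → v` forces `m u ≥ m v`, so `u` would be maximal too and precede `v`.
Flipping it lowers its height by one. At total height zero the orientations agree. -/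
theorem toricEquiv_of_height [Fintype V] (ω' : AcyclicOrientation G) (n : ℕ) :
    ∀ (ω : AcyclicOrientation G) (m : V → ℕ), ∑ i, m i = n →
      (∀ i j, G.Adj i j →
        (m i : ℤ) - m j = arcIndicator ω.Arc i j - arcIndicator ω'.Arc i j) →
      ω.ToricEquiv ω' := by
  classical
  induction n with
  | zero =>
    intro ω m hsum hm
    have hm0 : ∀ i, m i = 0 := fun i => (Finset.sum_eq_zero_iff.1 hsum) i (Finset.mem_univ i)
    have : ω = ω' := by
      ext i j
      by_cases hij : G.Adj i j
      · have h := hm i j hij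
        unfold arcIndicator at h
        rw [hm0, hm0] at h
        split_ifs at h <;> simp_all
      · exact iff_of_false (fun h => hij h.adj) (fun h => hij h.adj)
    rw [this]
    exact Relation.EqvGen.refl _
  | succ n ih =>
    intro ω m hsum hm
    have hne : Nonempty V := by
      by_contra h
      rw [not_nonempty_iff] at h
      simp at hsum
    obtain ⟨w, hw⟩ := Finite.exists_max m
    have hwpos : 0 < m w := by
      by_contra h
      have : ∑ i, m i = 0 := Finset.sum_eq_zero fun i _ => by have := hw i; omega
      omega
    obtain ⟨f, -, hf⟩ := exists_injective_strictMono_of_acyclic ω.acyclic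
    obtain ⟨v, hv, hvmin⟩ := Set.exists_min_image {i | m i = m w} f (Set.toFinite _) ⟨w, rfl⟩
    have hv : m v = m w := hv
    have hsource : ∀ u, ¬ ω.Arc u v := by
      intro u huv
      have h1 := hm u v huv.adj
      rw [arcIndicator_of huv] at h1
      have h2 : arcIndicator ω'.Arc u v ≤ 1 := by
        unfold arcIndicator
        split_ifs <;> simp
      have h3 := hw u
      have h4 := hvmin u (show m u = m w by omega)
      have h5 := hf u v huv
      omega
    obtain ⟨ω₁, hω₁⟩ := ω.exists_flip hsource
    -- The subtraction in `ℕ` does not truncate, because `m v` is the positive maximum.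
    refine Relation.EqvGen.trans _ ω₁ _ (Relation.EqvGen.rel _ _ ⟨v, hsource, hω₁⟩)
      (ih ω₁ (fun i => m i - if i = v then 1 else 0) ?_ ?_)
    · have h1 : ∑ i, (m i - if i = v then 1 else 0) + ∑ i, (if i = v then 1 else 0) = ∑ i, m i := by
        rw [← Finset.sum_add_distrib]
        refine Finset.sum_congr rfl fun i _ => ?_
        split_ifs with h
        · subst h; omega
        · omega
      rw [Finset.sum_ite_eq' Finset.univ v, if_pos (Finset.mem_univ v)] at h1
      omega
    · intro i j hij
      have h1 := hm i j hij
      have h2 := height_of_flip hsource hω₁ hij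
      have h3 : ∀ i, ((m i - (if i = v then 1 else 0) : ℕ) : ℤ) =
          (m i : ℤ) - (if i = v then (1 : ℤ) else 0) := by
        intro i
        split_ifs with h
        · subst h
          have : 0 < m i := by omega
          push_cast [Nat.cast_sub this]
          omega
        · simp
      rw [h3, h3]
      have h4 : ∀ i, (if i = v then (1 : ℤ) else 0) =
        @ite ℤ (i = v) (Classical.propDecidable _) 1 0 := fun i => by congr
      rw [h4 i, h4 j]
      linarith

/-- Height equivalent acyclic orientations of a finite graph are torically equivalent. -/
theorem toricEquiv_of_heightEquiv [Finite V] {ω ω' : AcyclicOrientation G}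
    (h : HeightEquiv G ω.Arc ω'.Arc) : ω.ToricEquiv ω' := by
  have := Fintype.ofFinite V
  obtain ⟨m, hm⟩ := h
  obtain ⟨M, hM⟩ := (Set.finite_range m).bddBelow
  have hM : ∀ i, M ≤ m i := fun i => hM ⟨i, rfl⟩
  refine toricEquiv_of_height ω' _ ω (fun i => (m i - M).toNat) rfl fun i j hij => ?_
  rw [Int.toNat_of_nonneg (sub_nonneg.2 (hM i)), Int.toNat_of_nonneg (sub_nonneg.2 (hM j)),
    ← hm i j hij]
  ring

end AcyclicOrientation

/-! ### Coordinates on the circle -/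

theorem modOne_coe (r : ℝ) : modOne (r : UnitAddCircle) = Int.fract r := by
  unfold modOne
  rw [AddCircle.coe_equivIco_mk_apply]
  simp

theorem coe_modOne (t : UnitAddCircle) : ((modOne t : ℝ) : UnitAddCircle) = t :=
  AddCircle.coe_equivIco

theorem modOne_injective : Function.Injective modOne := fun s t h => by
  rw [← coe_modOne s, h, coe_modOne]

theorem modOne_nonneg (t : UnitAddCircle) : 0 ≤ modOne t := by
  rw [← coe_modOne t, modOne_coe]
  exact Int.fract_nonneg _

theorem modOne_lt_one (t : UnitAddCircle) : modOne t < 1 := by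
  rw [← coe_modOne t, modOne_coe]
  exact Int.fract_lt_one _

theorem modOne_coe_of_mem {r : ℝ} (h0 : 0 ≤ r) (h1 : r < 1) : modOne (r : UnitAddCircle) = r := by
  rw [modOne_coe, Int.fract_eq_self.2 ⟨h0, h1⟩]

theorem continuousAt_modOne {t : UnitAddCircle} (ht : t ≠ 0) : ContinuousAt modOne t :=
  continuous_subtype_val.continuousAt.comp
    (AddCircle.continuousAt_equivIco 1 0 (by simpa using ht))

theorem UnitAddCircle.coe_eq_coe_iff {r s : ℝ} :
    (r : UnitAddCircle) = s ↔ ∃ n : ℤ, r - s = n := by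
  rw [← sub_eq_zero, ← AddCircle.coe_sub, AddCircle.coe_eq_zero_iff]
  simp [eq_comm]

/-- Needed to rotate finitely many coordinates away from `0`. -/
instance : Infinite UnitAddCircle :=
  have : Infinite (Set.Ico (0 : ℝ) (0 + 1)) := (Set.Ico_infinite (by norm_num)).to_subtype
  Infinite.of_injective _ (AddCircle.equivIco (1 : ℝ) 0).symm.injective

/-- The representative of smallest absolute value of a point of `ℝ/ℤ`. -/
noncomputable def shortLift (t : UnitAddCircle) : ℝ :=
  modOne t - round (modOne t)

theorem coe_shortLift (t : UnitAddCircle) : ((shortLift t : ℝ) : UnitAddCircle) = t := by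
  conv_rhs => rw [← coe_modOne t]
  rw [UnitAddCircle.coe_eq_coe_iff]
  exact ⟨-round (modOne t), by unfold shortLift; push_cast; ring⟩

theorem abs_shortLift (t : UnitAddCircle) : |shortLift t| = ‖t‖ := by
  conv_rhs => rw [← coe_modOne t]
  rw [UnitAddCircle.norm_eq, shortLift]

theorem shortLift_zero : shortLift 0 = 0 := by
  rw [← abs_eq_zero, abs_shortLift, norm_zero]

/-- `modOne` jumps at `0`; this continuity is what makes `nearLift` a local lift of the torus. -/
theorem continuousAt_shortLift_zero : ContinuousAt shortLift 0 := by
  unfold ContinuousAt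
  rw [shortLift_zero]
  refine squeeze_zero_norm (a := fun t => ‖t‖) (fun t => ?_) ?_
  · rw [Real.norm_eq_abs, abs_shortLift]
  · simpa using (continuous_norm (E := UnitAddCircle)).tendsto 0

open Filter Topology

/-! ### Points of the torus and their lifts -/

/-- The point of the torus with a given lift. -/
def toTorus {V : Type*} (a : V → ℝ) : V → UnitAddCircle := fun i => (a i : UnitAddCircle)

theorem continuous_toTorus {V : Type*} : Continuous (toTorus : (V → ℝ) → V → UnitAddCircle) :=
  continuous_pi fun i => (AddCircle.continuous_mk' 1).comp (continuous_apply i)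

theorem toTorus_modOne {V : Type*} (x : V → UnitAddCircle) :
    toTorus (fun i => modOne (x i)) = x :=
  funext fun i => coe_modOne (x i)

/-- The difference of the coordinates at each edge lies, for `a` and for `b`, strictly between the
same two consecutive integers. -/
def SameSide {V : Type*} (G : SimpleGraph V) (a b : V → ℝ) : Prop :=
  ∀ i j, G.Adj i j → ∃ k : ℤ, (k < a i - a j ∧ a i - a j < k + 1) ∧
    (k < b i - b j ∧ b i - b j < k + 1)

section

variable {V : Type*} {G : SimpleGraph V}

theorem SameSide.symm {a b : V → ℝ} (h : SameSide G a b) : SameSide G b a := fun i j hij => by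
  obtain ⟨k, h1, h2⟩ := h i j hij
  exact ⟨k, h2, h1⟩

theorem int_eq_of_mem_Ioo {k l : ℤ} {r : ℝ} (h : k < r ∧ r < k + 1) (h' : l < r ∧ r < l + 1) :
    k = l := by
  have h1 : (k : ℝ) < l + 1 := h.1.trans h'.2
  have h2 : (l : ℝ) < k + 1 := h'.1.trans h.2
  norm_cast at h1 h2
  omega

theorem SameSide.trans {a b d : V → ℝ} (h : SameSide G a b) (h' : SameSide G b d) :
    SameSide G a d := fun i j hij => by
  obtain ⟨k, h1, h2⟩ := h i j hij
  obtain ⟨l, h3, h4⟩ := h' i j hij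
  obtain rfl := int_eq_of_mem_Ioo h2 h3
  exact ⟨k, h1, h4⟩

theorem exists_int_of_notMem {a : V → ℝ} (ha : toTorus a ∉ toricArrangement G) {i j : V}
    (hij : G.Adj i j) : ∃ k : ℤ, k < a i - a j ∧ a i - a j < k + 1 := by
  refine ⟨⌊a i - a j⌋, lt_of_le_of_ne (Int.floor_le _) fun h => ha ⟨i, j, hij, ?_⟩,
    Int.lt_floor_add_one _⟩
  exact UnitAddCircle.coe_eq_coe_iff.2 ⟨_, h.symm⟩

theorem notMem_toricArrangement_of_exists_int {a : V → ℝ}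
    (h : ∀ i j, G.Adj i j → ∃ k : ℤ, k < a i - a j ∧ a i - a j < k + 1) :
    toTorus a ∉ toricArrangement G := by
  rintro ⟨i, j, hij, hx⟩
  obtain ⟨n, hn⟩ := UnitAddCircle.coe_eq_coe_iff.1 hx
  obtain ⟨k, h1, h2⟩ := h i j hij
  rw [hn] at h1 h2
  norm_cast at h1 h2
  omega

/-- Along the straight segment from `a` to `b` each edge difference stays in one open unit interval,
by convexity, so the image of the segment in the torus avoids the arrangement. -/
theorem SameSide.mem_connectedComponentIn {a b : V → ℝ} (h : SameSide G a b) :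
    toTorus b ∈ connectedComponentIn (toricArrangement G)ᶜ (toTorus a) := by
  have hs : IsPreconnected (toTorus '' segment ℝ a b) :=
    (convex_segment a b).isPreconnected.image _ continuous_toTorus.continuousOn
  refine hs.subset_connectedComponentIn ⟨a, left_mem_segment ℝ a b, rfl⟩ ?_
    ⟨b, right_mem_segment ℝ a b, rfl⟩
  rintro _ ⟨_, ⟨s, t, hs, ht, hst, rfl⟩, rfl⟩
  refine notMem_toricArrangement_of_exists_int fun i j hij => ?_
  obtain ⟨k, ⟨h1, h2⟩, h3, h4⟩ := h i j hij
  refine ⟨k, ?_⟩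
  simp only [Pi.add_apply, Pi.smul_apply, smul_eq_mul]
  have hconv := (convex_Ioo (k : ℝ) (k + 1)) ⟨h1, h2⟩ ⟨h3, h4⟩ hs ht hst
  simp only [smul_eq_mul, Set.mem_Ioo] at hconv
  constructor <;> linarith [hconv.1, hconv.2]

/-- The digraph of a point determines, from the integral parts of the coordinates of a lift, the
integral parts of the differences along the edges. -/
theorem floor_sub_eq {a : V → ℝ} {i j : V} (hij : G.Adj i j) {k : ℤ}
    (h : k < a i - a j ∧ a i - a j < k + 1) :
    k = ⌊a i⌋ - ⌊a j⌋ - arcIndicator (toricDigraph G (toTorus a)) i j := by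
  obtain ⟨h1, h2⟩ := h
  have hi := Int.floor_add_fract (a i)
  have hj := Int.floor_add_fract (a j)
  have hi0 := Int.fract_nonneg (a i)
  have hj0 := Int.fract_nonneg (a j)
  have hi1 := Int.fract_lt_one (a i)
  have hj1 := Int.fract_lt_one (a j)
  have hiff : toricDigraph G (toTorus a) i j ↔ Int.fract (a i) ≤ Int.fract (a j) := by
    simp [toricDigraph, toTorus, modOne_coe, hij]
  by_cases hle : Int.fract (a i) ≤ Int.fract (a j)
  · rw [arcIndicator_of (hiff.2 hle)]
    have h3 : (k : ℝ) < (⌊a i⌋ - ⌊a j⌋ : ℤ) := by push_cast; linarith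
    have h4 : ((⌊a i⌋ - ⌊a j⌋ : ℤ) : ℝ) < (k + 2 : ℤ) := by push_cast; linarith
    norm_cast at h3 h4
    omega
  · rw [arcIndicator_of_not (fun h => hle (hiff.1 h))]
    push Not at hle
    have h3 : ((k - 1 : ℤ) : ℝ) < (⌊a i⌋ - ⌊a j⌋ : ℤ) := by push_cast; linarith
    have h4 : ((⌊a i⌋ - ⌊a j⌋ : ℤ) : ℝ) < (k + 1 : ℤ) := by push_cast; linarith
    norm_cast at h3 h4
    omega

/-- The common integer at each edge, computed by `floor_sub_eq` for both lifts, shows that the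
difference of floors is a height function. -/
theorem SameSide.heightEquiv {a b : V → ℝ} (h : SameSide G a b) :
    HeightEquiv G (toricDigraph G (toTorus a)) (toricDigraph G (toTorus b)) := by
  refine ⟨fun i => ⌊a i⌋ - ⌊b i⌋, fun i j hij => ?_⟩
  obtain ⟨k, h1, h2⟩ := h i j hij
  linarith [floor_sub_eq hij h1, floor_sub_eq hij h2]

/-- Points off the arrangement that induce height equivalent digraphs lie in the same chamber. -/
theorem mem_connectedComponentIn_of_heightEquiv {x y : V → UnitAddCircle}
    (hx : x ∉ toricArrangement G) (hy : y ∉ toricArrangement G)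
    (h : HeightEquiv G (toricDigraph G x) (toricDigraph G y)) :
    y ∈ connectedComponentIn (toricArrangement G)ᶜ x := by
  obtain ⟨m, hm⟩ := h
  -- Shifting the lift of `x` by the height `m` moves its edge differences into the same unit
  -- intervals as those of `y`.
  have hxl : toTorus (fun i => modOne (x i) + m i) = x := by
    funext i
    conv_rhs => rw [← coe_modOne (x i)]
    exact UnitAddCircle.coe_eq_coe_iff.2 ⟨m i, by ring⟩
  have hxf : ∀ i, ⌊modOne (x i) + m i⌋ = m i := fun i => by
    rw [Int.floor_add_intCast, Int.floor_eq_zero_iff.2 ⟨modOne_nonneg _, modOne_lt_one _⟩, zero_add]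
  have hyf : ∀ i, ⌊modOne (y i)⌋ = 0 := fun i =>
    Int.floor_eq_zero_iff.2 ⟨modOne_nonneg _, modOne_lt_one _⟩
  have hside : SameSide G (fun i => modOne (x i) + m i) (fun i => modOne (y i)) := by
    intro i j hij
    obtain ⟨k, hk⟩ := exists_int_of_notMem (hxl.symm ▸ hx) hij
    obtain ⟨l, hl⟩ := exists_int_of_notMem ((toTorus_modOne y).symm ▸ hy) hij
    have h1 := floor_sub_eq (a := fun i => modOne (x i) + m i) hij hk
    have h2 := floor_sub_eq (a := fun i => modOne (y i)) hij hl
    rw [hxl, hxf, hxf] at h1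
    rw [toTorus_modOne, hyf, hyf] at h2
    have h3 := hm i j hij
    obtain rfl : k = l := by linarith
    exact ⟨k, hk, hl⟩
  have := hside.mem_connectedComponentIn
  rwa [hxl, toTorus_modOne] at this

theorem eventually_sameSide [Finite V] {a : V → ℝ} (ha : toTorus a ∉ toricArrangement G) :
    ∀ᶠ b in 𝓝 a, SameSide G a b := by
  unfold SameSide
  simp only [eventually_all]
  intro i j hij
  obtain ⟨k, hk⟩ := exists_int_of_notMem ha hij
  have hcont : Continuous fun b : V → ℝ => b i - b j := by fun_prop
  filter_upwards [hcont.continuousAt.eventually (Ioo_mem_nhds hk.1 hk.2)] with b hb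
  exact ⟨k, hk, hb⟩

/-- The lift of `y` that is nearest to a given lift `a` of `x`. -/
noncomputable def nearLift (a : V → ℝ) (x y : V → UnitAddCircle) : V → ℝ :=
  fun i => a i + shortLift (y i - x i)

theorem toTorus_nearLift {a : V → ℝ} {x : V → UnitAddCircle} (ha : toTorus a = x)
    (y : V → UnitAddCircle) : toTorus (nearLift a x y) = y := by
  subst ha
  funext i
  change ((a i + shortLift (y i - (a i : UnitAddCircle)) : ℝ) : UnitAddCircle) = y i
  rw [AddCircle.coe_add, coe_shortLift]
  abel

theorem tendsto_shortLift_sub (x : V → UnitAddCircle) (i : V) :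
    Tendsto (fun y : V → UnitAddCircle => shortLift (y i - x i)) (𝓝 x) (𝓝 0) := by
  have h1 : Tendsto (fun y : V → UnitAddCircle => y i - x i) (𝓝 x) (𝓝 0) := by
    have : Continuous fun y : V → UnitAddCircle => y i - x i := by fun_prop
    simpa using this.tendsto x
  have h2 := continuousAt_shortLift_zero.tendsto
  rw [shortLift_zero] at h2
  exact h2.comp h1

theorem tendsto_nearLift (a : V → ℝ) (x : V → UnitAddCircle) :
    Tendsto (nearLift a x) (𝓝 x) (𝓝 a) := by
  refine tendsto_pi_nhds.2 fun i => ?_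
  simpa [nearLift] using (tendsto_shortLift_sub x i).const_add (a i)

/-- The class of the induced digraph is locally constant off the arrangement, hence constant on
chambers. -/
theorem eventually_heightEquiv [Finite V] {x : V → UnitAddCircle}
    (hx : x ∉ toricArrangement G) :
    ∀ᶠ y in 𝓝 x, HeightEquiv G (toricDigraph G x) (toricDigraph G y) := by
  have hl := toTorus_modOne x
  filter_upwards [(tendsto_nearLift _ x).eventually (eventually_sameSide (hl.symm ▸ hx))] with y hy
  have := hy.heightEquiv
  rwa [hl, toTorus_nearLift hl] at this

/-- Points of the same chamber induce height equivalent digraphs. -/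
theorem heightEquiv_of_mem_connectedComponentIn [Finite V] {x y : V → UnitAddCircle}
    (h : y ∈ connectedComponentIn (toricArrangement G)ᶜ x) :
    HeightEquiv G (toricDigraph G x) (toricDigraph G y) := by
  have hx : x ∈ (toricArrangement G)ᶜ := connectedComponentIn_nonempty_iff.1 ⟨y, h⟩
  refine isPreconnected_connectedComponentIn.induction₂
    (fun x y => HeightEquiv G (toricDigraph G x) (toricDigraph G y))
    (fun z hz => ?_) (fun _ _ _ _ _ _ => HeightEquiv.trans) (fun _ _ _ _ => HeightEquiv.symm)
    (mem_connectedComponentIn hx) h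
  exact (eventually_heightEquiv (connectedComponentIn_subset _ _ hz)).filter_mono
    nhdsWithin_le_nhds

/-! ### Toric chambers -/

namespace IsToricChamber

variable {c : Set (V → UnitAddCircle)}

theorem notMem (hc : IsToricChamber G c) {x : V → UnitAddCircle} (hx : x ∈ c) :
    x ∉ toricArrangement G := by
  obtain ⟨y, -, rfl⟩ := hc
  exact connectedComponentIn_subset _ _ hx

theorem eq_connectedComponentIn (hc : IsToricChamber G c) {x : V → UnitAddCircle} (hx : x ∈ c) :
    c = connectedComponentIn (toricArrangement G)ᶜ x := by
  obtain ⟨y, -, rfl⟩ := hc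
  exact connectedComponentIn_eq hx

theorem nonempty (hc : IsToricChamber G c) : c.Nonempty := by
  obtain ⟨y, hy, rfl⟩ := hc
  exact ⟨y, mem_connectedComponentIn hy⟩

theorem mem_of_sameSide (hc : IsToricChamber G c) {a b : V → ℝ} (ha : toTorus a ∈ c)
    (h : SameSide G a b) : toTorus b ∈ c := by
  rw [hc.eq_connectedComponentIn ha]
  exact h.mem_connectedComponentIn

/-- A chamber is invariant under diagonal translations. -/
theorem add_const_mem (hc : IsToricChamber G c) {x : V → UnitAddCircle} (hx : x ∈ c)
    (θ : UnitAddCircle) : (fun i => x i + θ) ∈ c := by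
  have hl := toTorus_modOne x
  have h : SameSide G (fun i => modOne (x i)) (fun i => modOne (x i) + modOne θ) := by
    intro i j hij
    obtain ⟨k, hk⟩ := exists_int_of_notMem (hl.symm ▸ hc.notMem hx) hij
    exact ⟨k, hk, by rwa [add_sub_add_right_eq_sub]⟩
  have := hc.mem_of_sameSide (hl.symm ▸ hx) h
  convert this using 1
  funext i
  simp [toTorus, coe_modOne]

end IsToricChamber

/-- The orientation of `G` induced by a point off the toric arrangement. -/
def orientationOfPoint (G : SimpleGraph V) (x : V → UnitAddCircle) (hx : x ∉ toricArrangement G) :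
    AcyclicOrientation G where
  Arc := toricDigraph G x
  adj_iff i j := by
    have := le_total (modOne (x i)) (modOne (x j))
    have := G.adj_comm i j
    unfold toricDigraph
    tauto
  acyclic := acyclic_of_strictMono (f := fun i => modOne (x i)) fun i j h =>
    lt_of_le_of_ne h.2 fun he => hx ⟨i, j, h.1, modOne_injective he⟩

theorem toricDigraph_eq_of_lt {ω : AcyclicOrientation G} {x : V → UnitAddCircle}
    (h : ∀ i j, ω.Arc i j → modOne (x i) < modOne (x j)) : toricDigraph G x = ω.Arc := by
  funext i j
  refine propext ⟨fun ⟨hij, hle⟩ => ?_, fun hij => ⟨hij.adj, (h i j hij).le⟩⟩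
  exact ((ω.adj_iff i j).1 hij).resolve_right fun h' => absurd (h j i h') (not_lt.2 hle)

theorem notMem_toricArrangement_of_lt {ω : AcyclicOrientation G} {x : V → UnitAddCircle}
    (h : ∀ i j, ω.Arc i j → modOne (x i) < modOne (x j)) : x ∉ toricArrangement G := by
  rintro ⟨i, j, hij, he⟩
  rcases (ω.adj_iff i j).1 hij with h' | h'
  · exact (h i j h').ne (congrArg modOne he)
  · exact (h j i h').ne (congrArg modOne he.symm)

end

section

variable {V : Type*} {G : SimpleGraph V} {c : Set (V → UnitAddCircle)} {π : Setoid V}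

/-! ### Faces of chambers -/

/-- The point of the toric flat of `π` with given block coordinates. -/
def blockLift (π : Setoid V) (y : Quotient π → UnitAddCircle) : V → UnitAddCircle :=
  fun i => y (Quotient.mk π i)

theorem blockLift_mem_toricFlat (π : Setoid V) (y : Quotient π → UnitAddCircle) :
    blockLift π y ∈ toricFlat π :=
  fun _ _ hij => congrArg y (Quotient.sound hij)

theorem blockProjection_blockLift (π : Setoid V) (y : Quotient π → UnitAddCircle) :
    blockProjection π (blockLift π y) = y :=
  funext fun B => congrArg y (Quotient.out_eq B)

theorem blockLift_blockProjection {z : V → UnitAddCircle} (hz : z ∈ toricFlat π) :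
    blockLift π (blockProjection π z) = z :=
  funext fun i => hz _ _ (Quotient.exact (Quotient.out_eq (Quotient.mk π i)))

theorem continuous_blockLift (π : Setoid V) : Continuous (blockLift π) :=
  continuous_pi fun i => continuous_apply (Quotient.mk π i)

theorem mem_toricOpenFace {z : V → UnitAddCircle} :
    z ∈ toricOpenFace c π ↔ z ∈ toricFlat π ∧ ∀ᶠ z' in 𝓝[toricFlat π] z, z' ∈ closure c := by
  constructor
  · rintro ⟨⟨z, hz⟩, hmem, rfl⟩
    rw [mem_interior_iff_mem_nhds, preimage_coe_mem_nhds_subtype] at hmem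
    exact ⟨hz, mem_of_superset hmem Set.inter_subset_left⟩
  · rintro ⟨hz, hev⟩
    refine ⟨⟨z, hz⟩, ?_, rfl⟩
    rw [mem_interior_iff_mem_nhds, preimage_coe_mem_nhds_subtype]
    exact inter_mem hev self_mem_nhdsWithin

/-- The edges of `G` that join different blocks of `π`. -/
def crossGraph (G : SimpleGraph V) (π : Setoid V) : SimpleGraph V where
  Adj i j := G.Adj i j ∧ ¬ π i j
  symm := ⟨fun _ _ h => ⟨h.1.symm, fun h' => h.2 (π.symm h')⟩⟩
  loopless := ⟨fun i h => h.2 (π.refl i)⟩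

/-- Edges inside a block are dropped, since the lift always lies on their hyperplanes. -/
theorem blockLift_notMem {y : Quotient π → UnitAddCircle}
    (hy : y ∉ toricArrangement (quotientGraph G π)) :
    blockLift π y ∉ toricArrangement (crossGraph G π) := by
  rintro ⟨i, j, ⟨hij, hne⟩, he⟩
  exact hy ⟨_, _, ⟨fun h => hne (Quotient.exact h), i, j, rfl, rfl, hij⟩, he⟩

/-- Off the toric hyperplanes of `G/∼π`, every point of a closed face is interior to it. -/
theorem mem_toricOpenFace_of_mem_closure [Finite V] (hc : IsToricChamber G c)
    {y : Quotient π → UnitAddCircle} (hy : y ∉ toricArrangement (quotientGraph G π))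
    (hcl : blockLift π y ∈ closure c) : blockLift π y ∈ toricOpenFace c π := by
  refine mem_toricOpenFace.2 ⟨blockLift_mem_toricFlat π y, ?_⟩
  have hz := blockLift_notMem hy
  have hflat := blockLift_mem_toricFlat π y
  generalize blockLift π y = z at hz hcl hflat
  obtain ⟨a, rfl⟩ : ∃ a, toTorus a = z := ⟨_, toTorus_modOne z⟩
  set z := toTorus a with hzdef
  -- Here `p.1` is a nearby point `z'` of the flat and `p.2` a nearby point `x` of the chamber.
  -- Translating `x` by `z' - z` preserves differences inside blocks, and across blocks closeness to
  -- `z` keeps the sides. So the translate stays in `c`, and it tends to `z'` as `x` tends to `z`.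
  have hev : ∀ᶠ p in 𝓝 (z, z), SameSide (crossGraph G π) a (nearLift a z p.2) ∧
      SameSide (crossGraph G π) a
        (fun i => nearLift a z p.2 i + shortLift (p.1 i - z i)) := by
    have h2 : Tendsto (fun p : (V → UnitAddCircle) × (V → UnitAddCircle) => nearLift a z p.2)
        (𝓝 (z, z)) (𝓝 a) := (tendsto_nearLift a z).comp continuous_snd.continuousAt.tendsto
    refine (h2.eventually (eventually_sameSide hz)).and (Tendsto.eventually ?_
      (eventually_sameSide hz))
    refine tendsto_pi_nhds.2 fun i => ?_
    have h1 : Tendsto (fun p : (V → UnitAddCircle) × (V → UnitAddCircle) =>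
        shortLift (p.1 i - z i)) (𝓝 (z, z)) (𝓝 0) :=
      (tendsto_shortLift_sub z i).comp
        (continuous_fst (X := V → UnitAddCircle) (Y := V → UnitAddCircle)).continuousAt.tendsto
    simpa using ((tendsto_pi_nhds.1 h2) i).add h1
  filter_upwards [nhdsWithin_le_nhds hev.curry_nhds, self_mem_nhdsWithin] with z' hz' hflat'
  have htend : Tendsto (fun x => x + (z' - z)) (𝓝 z) (𝓝 z') := by
    have : Continuous fun x : V → UnitAddCircle => x + (z' - z) := by fun_prop
    simpa using this.tendsto z
  rw [mem_closure_iff_frequently]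
  refine htend.frequently (((mem_closure_iff_frequently.1 hcl).and_eventually hz').mono ?_)
  rintro x ⟨hx, hs1, hs2⟩
  have hxl := toTorus_nearLift hzdef.symm x
  have hside : SameSide G (nearLift a z x)
      (fun i => nearLift a z x i + shortLift (z' i - z i)) := by
    intro i j hij
    by_cases hπ : π i j
    · obtain ⟨k, hk⟩ := exists_int_of_notMem (hxl.symm ▸ hc.notMem hx) hij
      refine ⟨k, hk, ?_⟩
      beta_reduce
      rwa [hflat i j hπ, hflat' i j hπ, add_sub_add_right_eq_sub]
    · exact hs1.symm.trans hs2 i j ⟨hij, hπ⟩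
  have := hc.mem_of_sameSide (hxl.symm ▸ hx) hside
  convert this using 1
  funext i
  have hxi : ((nearLift a z x i : ℝ) : UnitAddCircle) = x i := congrFun hxl i
  simp only [toTorus, AddCircle.coe_add, coe_shortLift, hxi, Pi.add_apply, Pi.sub_apply]

/-- The chamber of `G/∼π` of a point that lifts to a closed face lies in the open face. -/
theorem connectedComponentIn_subset_toricOpenFace [Finite V] (hc : IsToricChamber G c)
    {y : Quotient π → UnitAddCircle} (hy : y ∉ toricArrangement (quotientGraph G π))
    (hcl : blockLift π y ∈ closure c) :
    connectedComponentIn (toricArrangement (quotientGraph G π))ᶜ y ⊆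
      blockProjection π '' toricOpenFace c π := by
  intro y' hy'
  have hoff := connectedComponentIn_subset (toricArrangement (quotientGraph G π))ᶜ y
  -- Lifting into `closure c` is a clopen condition off the hyperplanes of `G/∼π`: open by the
  -- preceding lemma, closed by continuity.
  have hiff : blockLift π y ∈ closure c ↔ blockLift π y' ∈ closure c := by
    refine isPreconnected_connectedComponentIn.induction₂
      (fun y y' => blockLift π y ∈ closure c ↔ blockLift π y' ∈ closure c)
      (fun u hu => nhdsWithin_le_nhds ?_) (fun _ _ _ _ _ _ => Iff.trans)
      (fun _ _ _ _ => Iff.symm) (mem_connectedComponentIn hy) hy'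
    have hcont := (continuous_blockLift π).tendsto u
    by_cases hu' : blockLift π u ∈ closure c
    · have h1 := (mem_toricOpenFace.1 (mem_toricOpenFace_of_mem_closure hc (hoff hu) hu')).2
      have h2 : Tendsto (blockLift π) (𝓝 u) (𝓝[toricFlat π] (blockLift π u)) :=
        tendsto_nhdsWithin_iff.2
          ⟨hcont, Eventually.of_forall fun v => blockLift_mem_toricFlat π v⟩
      filter_upwards [h2.eventually h1] with v hv
      exact iff_of_true hu' hv
    · filter_upwards [hcont.eventually (isClosed_closure.isOpen_compl.mem_nhds hu')] with v hv
      exact iff_of_false hu' hv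
  exact ⟨blockLift π y', mem_toricOpenFace_of_mem_closure hc (hoff hy') (hiff.1 hcl),
    blockProjection_blockLift π y'⟩

/-- A partition is closed as soon as its closed face has a point whose coordinates differ on
different blocks. -/
theorem toricPartitionClosure_eq_self {y : Quotient π → UnitAddCircle}
    (hy : Function.Injective y) (hcl : blockLift π y ∈ closure c) :
    toricPartitionClosure c π = π := by
  refine le_antisymm (sSup_le ?_) (le_sSup ⟨le_rfl, rfl⟩)
  rintro π' ⟨-, hface⟩ i j hij
  -- An equal face contains this point, whose distinct block coordinates prevent `π'` from merging
  -- blocks.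
  have hmem : blockLift π y ∈ toricClosedFace c π' :=
    hface.symm ▸ ⟨hcl, blockLift_mem_toricFlat π y⟩
  exact Quotient.exact (hy (hmem.2 i j hij))

/-! ### Acyclic quotients and points of closed faces -/

/-- An acyclic quotient of an orientation of the chamber gives a point of the closed chamber whose
coordinates coincide exactly on the blocks. -/
theorem exists_injective_blockLift_mem_closure [Finite V] {ω : AcyclicOrientation G}
    (hc : IsToricPosetOf G ω c) {ω' : AcyclicOrientation G} (h : ω.ToricEquiv ω')
    (hac : ω'.QuotientAcyclic π) :
    ∃ y : Quotient π → UnitAddCircle, Function.Injective y ∧ blockLift π y ∈ closure c := by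
  obtain ⟨f, hfinj, hf⟩ := exists_injective_strictMono_of_acyclic hac
  obtain ⟨g, -, hg⟩ := exists_injective_strictMono_of_acyclic ω'.acyclic
  obtain ⟨N, hN⟩ := (Set.finite_range f).bddAbove
  have hN : ∀ B, (f B : ℝ) + 1 ≤ N + 1 := fun B => by
    have : f B ≤ N := hN ⟨B, rfl⟩
    exact_mod_cast Nat.succ_le_succ this
  obtain ⟨M, hM⟩ := (Set.finite_range g).bddAbove
  have hM : ∀ i, (g i : ℝ) < M + 1 := fun i => by
    have : g i ≤ M := hM ⟨i, rfl⟩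
    exact_mod_cast Nat.lt_succ_of_le this
  have hN0 : (0 : ℝ) < N + 1 := by positivity
  have hM0 : (0 : ℝ) < M + 1 := by positivity
  -- The linear extension `f` separates the blocks, `ε` times the normalised `g` orders vertices
  -- within a block, and division by `N + 1` keeps everything in `[0, 1)`. Letting `ε` tend to `0`
  -- collapses the blocks.
  let F : ℝ → V → ℝ := fun ε i => (f (Quotient.mk π i) + ε * (g i / (M + 1))) / (N + 1)
  have hF : ∀ ε, 0 < ε → ε < 1 → toTorus (F ε) ∈ c := by
    intro ε h0 h1
    have hq0 : ∀ i, 0 ≤ ε * (g i / (M + 1)) := fun i => by positivity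
    have hq1 : ∀ i, ε * (g i / (M + 1)) < 1 := fun i => by
      have : (g i : ℝ) / (M + 1) < 1 := (div_lt_one hM0).2 (hM i)
      have h2 : 0 ≤ (g i : ℝ) / (M + 1) := by positivity
      nlinarith
    have hmod : ∀ i, modOne (toTorus (F ε) i) = F ε i := fun i => by
      refine modOne_coe_of_mem (div_nonneg (add_nonneg (Nat.cast_nonneg _) (hq0 i)) hN0.le) ?_
      rw [div_lt_one hN0]
      linarith [hq1 i, hN (Quotient.mk π i)]
    have hlt : ∀ i j, ω'.Arc i j → modOne (toTorus (F ε) i) < modOne (toTorus (F ε) j) := by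
      intro i j hij
      rw [hmod, hmod]
      refine div_lt_div_of_pos_right ?_ hN0
      by_cases hb : Quotient.mk π i = Quotient.mk π j
      · have : (g i : ℝ) < g j := by exact_mod_cast hg i j hij
        rw [hb]
        gcongr
      · have h2 : f (Quotient.mk π i) + 1 ≤ f (Quotient.mk π j) :=
          hf _ _ ⟨hb, i, j, rfl, rfl, hij⟩
        have h2 : (f (Quotient.mk π i) : ℝ) + 1 ≤ f (Quotient.mk π j) := by exact_mod_cast h2
        linarith [hq1 i, hq0 j]
    obtain ⟨hch, x, hx, hxω⟩ := hc
    rw [hch.eq_connectedComponentIn hx]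
    refine mem_connectedComponentIn_of_heightEquiv (hch.notMem hx)
      (notMem_toricArrangement_of_lt hlt) ?_
    rw [hxω, toricDigraph_eq_of_lt hlt]
    exact h.heightEquiv
  refine ⟨fun B => ((f B / (N + 1) : ℝ) : UnitAddCircle), fun B C hBC => ?_, ?_⟩
  · have hmem : ∀ B, (f B / (N + 1) : ℝ) ∈ Set.Ico (0 : ℝ) (0 + 1) := fun B => by
      refine ⟨by positivity, ?_⟩
      rw [zero_add, div_lt_one hN0]
      linarith [hN B]
    have h1 := (AddCircle.coe_eq_coe_iff_of_mem_Ico (hmem B) (hmem C)).1 hBC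
    rw [div_left_inj' hN0.ne'] at h1
    exact hfinj (by exact_mod_cast h1)
  · have hcont : Continuous fun ε => toTorus (F ε) := by
      refine continuous_toTorus.comp (continuous_pi fun i => ?_)
      fun_prop
    have h0 : toTorus (F 0) =
        blockLift π fun B => ((f B / (N + 1) : ℝ) : UnitAddCircle) := by
      funext i
      simp [toTorus, F, blockLift]
    rw [← h0]
    refine mem_closure_of_tendsto (b := 𝓝[>] (0 : ℝ))
      ((hcont.tendsto 0).mono_left nhdsWithin_le_nhds) ?_
    filter_upwards [Ioo_mem_nhdsGT (zero_lt_one' ℝ)] with ε hε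
    exact hF ε hε.1 hε.2

/-- A point of a closed face off the toric hyperplanes of `G/∼π` gives an orientation of the chamber
with an acyclic quotient. -/
theorem exists_quotientAcyclic_of_mem_closure [Finite V] {ω : AcyclicOrientation G}
    (hc : IsToricPosetOf G ω c) {y : Quotient π → UnitAddCircle}
    (hy : y ∉ toricArrangement (quotientGraph G π)) (hcl : blockLift π y ∈ closure c) :
    ∃ ω' : AcyclicOrientation G, ω.ToricEquiv ω' ∧ ω'.QuotientAcyclic π := by
  obtain ⟨hch, x₀, hx₀, hω⟩ := hc
  -- A diagonal rotation moves every coordinate off `0`, where `modOne` is discontinuous, without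
  -- leaving the chamber.
  obtain ⟨θ, hθ⟩ := (Set.finite_range fun B => -y B).infinite_compl.nonempty
  have hθ : ∀ B, y B + θ ≠ 0 := fun B h => hθ ⟨B, (neg_eq_of_add_eq_zero_right h)⟩
  have hev : ∀ᶠ x in 𝓝 (blockLift π y), ∀ i j,
      modOne (blockLift π y i + θ) < modOne (blockLift π y j + θ) →
        modOne (x i + θ) < modOne (x j + θ) := by
    simp only [eventually_all]
    intro i j hlt
    have hcont : ∀ i, ContinuousAt (fun x : V → UnitAddCircle => modOne (x i + θ))
        (blockLift π y) := fun i =>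
      ContinuousAt.comp (f := fun x : V → UnitAddCircle => x i + θ)
        (continuousAt_modOne (hθ (Quotient.mk π i)))
        ((continuous_apply i).add continuous_const).continuousAt
    exact (hcont i).eventually_lt (hcont j) hlt
  obtain ⟨x, hx, hmono⟩ := ((mem_closure_iff_frequently.1 hcl).and_eventually hev).exists
  have hxθ := hch.add_const_mem hx θ
  refine ⟨orientationOfPoint G _ (hch.notMem hxθ), ?_, ?_⟩
  · apply AcyclicOrientation.toricEquiv_of_heightEquiv
    rw [← hω]
    rw [hch.eq_connectedComponentIn hx₀] at hxθ
    exact heightEquiv_of_mem_connectedComponentIn hxθ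
  · refine acyclic_of_strictMono (f := fun B => modOne (y B + θ)) ?_
    rintro _ _ ⟨hne, i, j, rfl, rfl, hij, hle⟩
    -- A reversed strict inequality would persist at `x` and contradict the arc; equality would put
    -- `y` on a hyperplane of `G/∼π`.
    refine lt_of_not_ge fun hge => ?_
    rcases hge.lt_or_eq with hlt | heq
    · exact absurd (hmono j i hlt) (not_lt.2 hle)
    · exact hy ⟨_, _, ⟨hne, i, j, rfl, rfl, hij⟩,
        (add_right_cancel (modOne_injective heq)).symm⟩

end

theorem corollary6p1 {V : Type*} [Finite V] (G : SimpleGraph V) (ω : AcyclicOrientation G)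
    (c : Set (V → UnitAddCircle)) (hc : IsToricPosetOf G ω c) (π : Setoid V) :
    (∃ c' : Set (Quotient π → UnitAddCircle), IsToricQuotientMorphism G π c c') ↔
      ∃ ω' : AcyclicOrientation G, ω.ToricEquiv ω' ∧ ω'.QuotientAcyclic π := by
  constructor
  · rintro ⟨c', h⟩
    obtain ⟨y, hy⟩ := h.target.nonempty
    obtain ⟨z, hz, rfl⟩ := h.subset_face hy
    obtain ⟨hflat, hev⟩ := mem_toricOpenFace.1 hz
    refine exists_quotientAcyclic_of_mem_closure hc (h.target.notMem hy) ?_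
    rw [blockLift_blockProjection hflat]
    exact hev.self_of_nhdsWithin hflat
  · rintro ⟨ω', hω', hac⟩
    obtain ⟨y, hy, hcl⟩ := exists_injective_blockLift_mem_closure hc hω' hac
    have hoff : y ∉ toricArrangement (quotientGraph G π) := by
      rintro ⟨B, C, hBC, he⟩
      exact hBC.1 (hy he)
    exact ⟨_, hc.1, ⟨y, hoff, rfl⟩, toricPartitionClosure_eq_self hy hcl,
      connectedComponentIn_subset_toricOpenFace hc.1 hoff hcl⟩
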